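/- **Networks and codes.** A network is a finite directed acyclic multigraph in which each of finitely many messages originates at some node (a source) and in which some nodes (receivers) demand certain messages. For integers $k,n\ge 1$ and an alphabet $\mathcal A$ (a finite set with at least two elements), each message is a vector in $\mathcal A^k$ and each edge carries a vector in $\mathcal A^n$. The inputs of a node are the messages originating at it and the vectors on its incoming edges. A $(k,n)$ code over $\mathcal A$ assigns to each edge a function from the inputs of its tail to $\mathcal A^n$, and to each receiver and each message it demands a decoding function from the receiver's inputs to $\mathcal A^k$. The code is a solution if, for all values of the messages, every receiver's decoding functions return the messages it demands. If $\mathcal A=\mathbb F$ is a finite field, the code is linear over $\mathbb F$ if every edge function and every decoding function has the form $(x_1,\dots,x_i,y_1,\dots,y_j)\mapsto M_1x_1+\dots+M_ix_i+M'_1y_1+\dots+M'_jy_j$ with constant matrices over $\mathbb F$. The capacity of a network is $\sup\{k/n:\text{a }(k,n)\text{ solution exists over some alphabet}\}$, and its linear capacity over $\mathbb F$ is $\sup\{k/n:\text{a }(k,n)\text{ linear solution over }\mathbb F\text{ exists}\}$. A disjoint union of networks has as nodes, edges, messages, sources and receivers the disjoint unions of those of its components. **The networks.** For $m\ge2$,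 the block $B(m)$ has inputs $y_0,\dots,y_m$ (messages from source nodes), nodes $u_0,\dots,u_m,u,v_0,\dots,v_m,v$ and receivers $R_0,\dots,R_m$. There is one edge to $u_i$ from the source of $y_j$ for each $j\ne i$, one edge to $u$ from the source of $y_j$ for each $j$, and one edge each $u_i\to v_i$, $u\to v$, $v_i\to R_i$ and $v\to R_i$; the receiver $R_i$ demands $y_i$. The $i$th output edge of the block is one further edge leaving $v_i$. * $\mathcal N_1(m)$ ($m\ge2$) consists of one block $B(m)$ whose inputs are messages $x_0,\dots,x_m$ with one source each, and a receiver $R_x$ at which all the output edges end and which demands $x_0$. * $\mathcal N_2(m,w)$ ($m\ge 2$, $w\ge1$) consists of $w$ blocks $B(m+1)$. The $0$th input of every block is one shared message $z$, and the $l$th block has $m+1$ further messages $x^{(l)}_1,\dots,x^{(l)}_{m+1}$ of its own as its other inputs, each message having its own source. All the output edges of the blocks except the $0$th ones end at an additional receiver $R_z$, which demands $z$. * $\mathcal N_3(m_1,m_2)$ ($m_1,m_2\ge 2$) consists of two blocks $B(m_1)$ and $B(m_2)$. The $0$th input of both is one shared message $z$, and for $l=1,2$ the block $B(m_l)$ has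 $m_l$ further messages of its own as its other inputs, each message having its own source. All the output edges of both blocks end at an additional receiver $R_z$, which demands $z$. For $m\ge2$ with prime factorization $m=p_1^{\gamma_1}\cdots p_\omega^{\gamma_\omega}$ (distinct primes $p_i$, all $\gamma_i\ge1$), put $$f(m)=\prod_{i}p_i^{\gamma_i-1},\qquad \mu(m,i)=\min\{\alpha\ge0: p_i^\alpha\ge f(m)\},\qquad g(m,i)=p_i^{\gamma_i-1}\prod_{j\ne i}p_j^{\mu(m,j)},$$ and let $\mathcal N_4(m)$ be the disjoint union of the networks $\mathcal N_1(q)$ for all primes $q<f(m)$ with $q\nmid m$, the networks $\mathcal N_2(p_i^{\gamma_i},m/p_i^{\gamma_i})$ for $1\le i\le\omega$, and the networks $\mathcal N_3(p_i,g(m,i))$ for all $i$ with $\gamma_i>1$. **Theorem.** For each integer $m\ge2$: (a) the capacity of $\mathcal N_4(m)$ equals $1$; (b) if $m$ is composite, then the linear capacity of $\mathcal N_4(m)$ over finite-field alphabets is bounded away from $1$: there is a constant $c<1$, depending only on $m$, such that for every finite field $\mathbb F$ the linear capacity of $\mathcal N_4(m)$ over $\mathbb F$ is at most $c$. -/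

import Mathlib

open scoped ENNReal Matrix

universe u

/-- A network: a finite directed acyclic multigraph, together with a finite set of messages, the
node at which each message originates (a source node is a node at which some message originates),
and, for each node, the set of messages it demands (a receiver is a node that demands some
message). -/
structure Network where
  Node : Type
  Edge : Type
  Msg : Type
  finite_node : Finite Node
  finite_edge : Finite Edge
  finite_msg : Finite Msg
  /-- the tail of an edge -/
  src : Edge → Node
  /-- the head of an edge -/
  tgt : Edge → Node
  origin : Msg → Node
  demands : Node → Set Msg
  acyclic : ∀ v : Node, ¬ Relation.TransGen (fun a b => ∃ e, src e = a ∧ tgt e = b) v v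

namespace Network

/-- The messages originating at a node. -/
def MsgAt (N : Network) (v : N.Node) : Type := {x : N.Msg // N.origin x = v}

/-- The incoming edges of a node. -/
def InEdge (N : Network) (v : N.Node) : Type := {e : N.Edge // N.tgt e = v}

noncomputable instance (N : Network) (v : N.Node) : Fintype (N.MsgAt v) :=
  have := N.finite_msg
  have : Finite (N.MsgAt v) := Subtype.finite
  Fintype.ofFinite _

noncomputable instance (N : Network) (v : N.Node) : Fintype (N.InEdge v) :=
  have := N.finite_edge
  have : Finite (N.InEdge v) := Subtype.finite
  Fintype.ofFinite _

/-- The possible values of the inputs of a node `v`: a vector of `k` symbols for each message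
originating at `v`, and a vector of `n` symbols for each incoming edge of `v`. -/
abbrev Inputs (N : Network) (A : Type u) (k n : ℕ) (v : N.Node) : Type u :=
  (N.MsgAt v → Fin k → A) × (N.InEdge v → Fin n → A)

/-- A `(k, n)` code over the alphabet `A`: an edge function for each edge, and a decoding function
for each receiver and each message it demands. -/
structure Code (N : Network) (A : Type u) (k n : ℕ) where
  edgeFn : ∀ e : N.Edge, N.Inputs A k n (N.src e) → Fin n → A
  decode : ∀ v : N.Node, N.demands v → N.Inputs A k n v → Fin k → A

theorem wellFounded_edge (N : Network) :
    WellFounded (fun e f : N.Edge => N.tgt e = N.src f) := by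
  have := N.finite_edge
  let r : N.Edge → N.Edge → Prop := Relation.TransGen (fun e f => N.tgt e = N.src f)
  have key : ∀ e f, r e f →
      Relation.TransGen (fun a b => ∃ e, N.src e = a ∧ N.tgt e = b) (N.src e) (N.src f) := by
    intro e f h
    induction h with
    | single h => exact Relation.TransGen.single ⟨e, rfl, h⟩
    | @tail b c _ h ih => exact ih.tail ⟨b, rfl, h⟩
  have htr : IsTrans N.Edge r := ⟨fun _ _ _ h h' => Relation.TransGen.trans h h'⟩
  have hir : Std.Irrefl r := ⟨fun e h => N.acyclic _ (key e e h)⟩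
  have hwf : WellFounded r := Finite.wellFounded_of_trans_of_irrefl r
  exact Subrelation.wf (r := r) (fun {e f} h => Relation.TransGen.single h) hwf

namespace Code

variable {N : Network} {A : Type u} {k n : ℕ}

/-- The vector of symbols carried by each edge under the code `c` when the messages are `x`. -/
noncomputable def edgeSymbol (c : N.Code A k n) (x : N.Msg → Fin k → A) : N.Edge → Fin n → A :=
  N.wellFounded_edge.fix fun e ih =>
    c.edgeFn e (fun y => x y.1, fun f => ih f.1 f.2)

/-- The inputs of the node `v` under the code `c` when the messages are `x`. -/
noncomputable def inputs (c : N.Code A k n) (x : N.Msg → Fin k → A) (v : N.Node) :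
    N.Inputs A k n v :=
  (fun y => x y.1, fun f => c.edgeSymbol x f.1)

theorem edgeSymbol_eq (c : N.Code A k n) (x : N.Msg → Fin k → A) (e : N.Edge) :
    c.edgeSymbol x e = c.edgeFn e (c.inputs x (N.src e)) := by
  unfold edgeSymbol
  rw [WellFounded.fix_eq]
  rfl

/-- The code is a solution: for all values of the messages, each receiver recovers each of its
demands. -/
def IsSolution (c : N.Code A k n) : Prop :=
  ∀ (x : N.Msg → Fin k → A) (v : N.Node) (d : N.demands v),
    c.decode v d (c.inputs x v) = x d.1

end Code

/-- A function of the inputs of a node over a ring alphabet is linear if it has the form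
`M₁ x₁ + ⋯ + Mᵢ xᵢ + M'₁ y₁ + ⋯ + M'ⱼ yⱼ` for constant matrices, where the `x`s are the message
vectors and the `y`s are the vectors on the incoming edges. -/
def IsLinearFn {N : Network} {F : Type u} [Ring F] {k n r : ℕ} {v : N.Node}
    (φ : N.Inputs F k n v → Fin r → F) : Prop :=
  ∃ (M : N.MsgAt v → Matrix (Fin r) (Fin k) F) (M' : N.InEdge v → Matrix (Fin r) (Fin n) F),
    ∀ s : N.Inputs F k n v, φ s = ∑ y, M y *ᵥ s.1 y + ∑ e, M' e *ᵥ s.2 e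

/-- A code over a ring alphabet is linear if all edge and decoding functions are. -/
def Code.IsLinear {N : Network} {F : Type u} [Ring F] {k n : ℕ} (c : N.Code F k n) : Prop :=
  (∀ e, IsLinearFn (c.edgeFn e)) ∧ ∀ v d, IsLinearFn (c.decode v d)

/-- The capacity: the supremum of `k / n` over all `(k, n)` such that a `(k, n)` solution exists
over some alphabet (a finite set with at least two elements). -/
noncomputable def capacity (N : Network) : ℝ≥0∞ :=
  sSup {r | ∃ k n : ℕ, 0 < k ∧ 0 < n ∧ r = (k : ℝ≥0∞) / n ∧
    ∃ A : Type, Finite A ∧ Nontrivial A ∧ ∃ c : N.Code A k n, c.IsSolution}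

/-- The linear capacity with respect to the ring alphabet `F`: the supremum of `k / n` over all
`(k, n)` such that a `(k, n)` linear solution over `F` exists. -/
noncomputable def linearCapacity (N : Network) (F : Type u) [Ring F] : ℝ≥0∞ :=
  sSup {r | ∃ k n : ℕ, 0 < k ∧ 0 < n ∧ r = (k : ℝ≥0∞) / n ∧
    ∃ c : N.Code F k n, c.IsLinear ∧ c.IsSolution}

/-- The disjoint union of a finite family of networks. -/
abbrev disjointUnion {ι : Type} [Finite ι] (N : ι → Network) : Network where
  Node := Σ i, (N i).Node
  Edge := Σ i, (N i).Edge
  Msg := Σ i, (N i).Msg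
  finite_node := have := fun i => (N i).finite_node; inferInstance
  finite_edge := have := fun i => (N i).finite_edge; inferInstance
  finite_msg := have := fun i => (N i).finite_msg; inferInstance
  src e := ⟨e.1, (N e.1).src e.2⟩
  tgt e := ⟨e.1, (N e.1).tgt e.2⟩
  origin x := ⟨x.1, (N x.1).origin x.2⟩
  demands v := {x | ∃ d ∈ (N v.1).demands v.2, x = ⟨v.1, d⟩}
  acyclic := by
    intro v hv
    have key : ∀ w : (Σ i, (N i).Node), Relation.TransGen
        (fun a b : (Σ i, (N i).Node) => ∃ e : (Σ i, (N i).Edge),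
          (⟨e.1, (N e.1).src e.2⟩ : Σ i, (N i).Node) = a ∧
          (⟨e.1, (N e.1).tgt e.2⟩ : Σ i, (N i).Node) = b) v w →
        ∃ b : (N v.1).Node, w = ⟨v.1, b⟩ ∧ Relation.TransGen
          (fun a b => ∃ e, (N v.1).src e = a ∧ (N v.1).tgt e = b) v.2 b := by
      intro w hw
      induction hw with
      | single h =>
        obtain ⟨e, rfl, rfl⟩ := h
        exact ⟨_, rfl, Relation.TransGen.single ⟨e.2, rfl, rfl⟩⟩
      | tail _ h ih =>
        obtain ⟨b, rfl, hb⟩ := ih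
        obtain ⟨⟨i, e⟩, he, rfl⟩ := h
        obtain ⟨rfl, he⟩ := Sigma.mk.inj_iff.1 he
        exact ⟨_, rfl, hb.tail ⟨e, eq_of_heq he, rfl⟩⟩
    obtain ⟨b, hb, h⟩ := key v hv
    obtain ⟨i, a⟩ := v
    obtain rfl : a = b := eq_of_heq (Sigma.mk.inj_iff.1 hb).2
    exact (N i).acyclic a h

/-! ### Networks made of building blocks

The building block `B(m)` has inputs `y₀, …, yₘ`, and nodes `u₀, …, uₘ, u`, `v₀, …, vₘ, v` and
receivers `R₀, …, Rₘ`. -/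

/-- The nodes of a network consisting of blocks `B(b l)`, one for each `l : ι`, of one source node
for each message in `M`, and of one additional receiver. -/
inductive BlockNode (ι : Type) (b : ι → ℕ) (M : Type) : Type
  /-- the source node generating the message `x` -/
  | source (x : M)
  /-- the node `uᵢ` of block `l` -/
  | uAt (l : ι) (i : Fin (b l + 1))
  /-- the node `u` of block `l` -/
  | uAll (l : ι)
  /-- the node `vᵢ` of block `l` -/
  | vAt (l : ι) (i : Fin (b l + 1))
  /-- the node `v` of block `l` -/
  | vAll (l : ι)
  /-- the receiver `Rᵢ` of block `l` -/
  | receiver (l : ι) (i : Fin (b l + 1))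
  /-- the additional receiver -/
  | extra

/-- The edges of a network consisting of blocks `B(b l)`, one for each `l : ι`, of source nodes,
and of one additional receiver, which receives the `i`th output edge of block `l` for each
`i ∈ out l`. -/
inductive BlockEdge (ι : Type) (b : ι → ℕ) (out : ∀ l, Set (Fin (b l + 1))) : Type
  /-- the edge to `uᵢ` from the source of the `j`th input, for `j ≠ i` -/
  | sourceU (l : ι) (i j : Fin (b l + 1)) (h : j ≠ i)
  /-- the edge to `u` from the source of the `j`th input -/
  | sourceUAll (l : ι) (j : Fin (b l + 1))
  /-- the edge from `uᵢ` to `vᵢ`, carrying `eᵢ` -/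
  | uv (l : ι) (i : Fin (b l + 1))
  /-- the edge from `u` to `v`, carrying `e` -/
  | uvAll (l : ι)
  /-- the edge from `vᵢ` to `Rᵢ` -/
  | vReceiver (l : ι) (i : Fin (b l + 1))
  /-- the edge from `v` to `Rᵢ` -/
  | vAllReceiver (l : ι) (i : Fin (b l + 1))
  /-- the `i`th output edge of block `l`, from `vᵢ` to the additional receiver -/
  | output (l : ι) (i : Fin (b l + 1)) (h : i ∈ out l)

section Block

variable {ι : Type} {b : ι → ℕ} {M : Type} {out : ∀ l, Set (Fin (b l + 1))}

theorem BlockNode.finite [Finite ι] [Finite M] : Finite (BlockNode ι b M) := by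
  let P := Σ l, Fin (b l + 1)
  let f : M ⊕ P ⊕ ι ⊕ P ⊕ ι ⊕ P ⊕ Unit → BlockNode ι b M :=
    Sum.elim .source <| Sum.elim (fun p => .uAt p.1 p.2) <| Sum.elim .uAll <|
      Sum.elim (fun p => .vAt p.1 p.2) <| Sum.elim .vAll <|
      Sum.elim (fun p => .receiver p.1 p.2) fun _ => .extra
  refine Finite.of_surjective f ?_
  rintro (x | ⟨l, i⟩ | l | ⟨l, i⟩ | l | ⟨l, i⟩ | _)
  · exact ⟨.inl x, rfl⟩
  · exact ⟨.inr (.inl ⟨l, i⟩), rfl⟩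
  · exact ⟨.inr (.inr (.inl l)), rfl⟩
  · exact ⟨.inr (.inr (.inr (.inl ⟨l, i⟩))), rfl⟩
  · exact ⟨.inr (.inr (.inr (.inr (.inl l)))), rfl⟩
  · exact ⟨.inr (.inr (.inr (.inr (.inr (.inl ⟨l, i⟩))))), rfl⟩
  · exact ⟨.inr (.inr (.inr (.inr (.inr (.inr ()))))), rfl⟩

theorem BlockEdge.finite [Finite ι] : Finite (BlockEdge ι b out) := by
  let P := Σ l, Fin (b l + 1)
  let Q := Σ l, {p : Fin (b l + 1) × Fin (b l + 1) // p.2 ≠ p.1}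
  let O := Σ l, {i : Fin (b l + 1) // i ∈ out l}
  let f : Q ⊕ P ⊕ P ⊕ ι ⊕ P ⊕ P ⊕ O → BlockEdge ι b out :=
    Sum.elim (fun q => .sourceU q.1 q.2.1.1 q.2.1.2 q.2.2) <|
      Sum.elim (fun p => .sourceUAll p.1 p.2) <| Sum.elim (fun p => .uv p.1 p.2) <|
      Sum.elim .uvAll <| Sum.elim (fun p => .vReceiver p.1 p.2) <|
      Sum.elim (fun p => .vAllReceiver p.1 p.2) fun o => .output o.1 o.2.1 o.2.2
  refine Finite.of_surjective f ?_
  rintro (⟨l, i, j, h⟩ | ⟨l, j⟩ | ⟨l, i⟩ | l | ⟨l, i⟩ | ⟨l, i⟩ | ⟨l, i, h⟩)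
  · exact ⟨.inl ⟨l, ⟨⟨i, j⟩, h⟩⟩, rfl⟩
  · exact ⟨.inr (.inl ⟨l, j⟩), rfl⟩
  · exact ⟨.inr (.inr (.inl ⟨l, i⟩)), rfl⟩
  · exact ⟨.inr (.inr (.inr (.inl l))), rfl⟩
  · exact ⟨.inr (.inr (.inr (.inr (.inl ⟨l, i⟩)))), rfl⟩
  · exact ⟨.inr (.inr (.inr (.inr (.inr (.inl ⟨l, i⟩))))), rfl⟩
  · exact ⟨.inr (.inr (.inr (.inr (.inr (.inr ⟨l, ⟨i, h⟩⟩))))), rfl⟩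

/-- The tail of an edge, where `inp l j` is the message that is the `j`th input of block `l`. -/
def BlockEdge.src (inp : ∀ l, Fin (b l + 1) → M) : BlockEdge ι b out → BlockNode ι b M
  | .sourceU l _ j _ => .source (inp l j)
  | .sourceUAll l j => .source (inp l j)
  | .uv l i => .uAt l i
  | .uvAll l => .uAll l
  | .vReceiver l i => .vAt l i
  | .vAllReceiver l _ => .vAll l
  | .output l i _ => .vAt l i

/-- The head of an edge. -/
def BlockEdge.tgt : BlockEdge ι b out → BlockNode ι b M
  | .sourceU l i _ _ => .uAt l i
  | .sourceUAll l _ => .uAll l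
  | .uv l i => .vAt l i
  | .uvAll l => .vAll l
  | .vReceiver l i => .receiver l i
  | .vAllReceiver l i => .receiver l i
  | .output _ _ _ => .extra

/-- The demands: the receiver `Rᵢ` of block `l` demands the `i`th input of block `l`, and the
additional receiver demands the message `z`. -/
def BlockNode.demands (inp : ∀ l, Fin (b l + 1) → M) (z : M) : BlockNode ι b M → Set M
  | .receiver l i => {inp l i}
  | .extra => {z}
  | _ => ∅

/-- The depth of a node. -/
def BlockNode.depth : BlockNode ι b M → ℕ
  | .source _ => 0
  | .uAt _ _ => 1
  | .uAll _ => 1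
  | .vAt _ _ => 2
  | .vAll _ => 2
  | .receiver _ _ => 3
  | .extra => 3

end Block

/-- The network made of blocks `B(b l)`, one for each `l : ι`, where the `j`th input of block `l`
comes from the source node of the message `inp l j`, together with an additional receiver which
receives the `i`th output edge of block `l` for each `i ∈ out l` and demands the message `z`. -/
abbrev blockNetwork {ι : Type} [Finite ι] (b : ι → ℕ) {M : Type} [Finite M]
    (inp : ∀ l, Fin (b l + 1) → M) (out : ∀ l, Set (Fin (b l + 1))) (z : M) : Network where
  Node := BlockNode ι b M
  Edge := BlockEdge ι b out
  Msg := M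
  finite_node := BlockNode.finite
  finite_edge := BlockEdge.finite
  finite_msg := inferInstance
  src := BlockEdge.src inp
  tgt := BlockEdge.tgt
  origin := BlockNode.source
  demands := BlockNode.demands inp z
  acyclic := by
    intro v hv
    have key : ∀ w : BlockNode ι b M, Relation.TransGen (fun a c : BlockNode ι b M =>
        ∃ e : BlockEdge ι b out, e.src inp = a ∧ e.tgt = c) v w → v.depth < w.depth := by
      intro w hw
      induction hw with
      | single h =>
        obtain ⟨e, rfl, rfl⟩ := h
        cases e <;> simp [BlockEdge.src, BlockEdge.tgt, BlockNode.depth]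
      | tail _ h ih =>
        obtain ⟨e, rfl, rfl⟩ := h
        refine ih.trans ?_
        cases e <;> simp [BlockEdge.src, BlockEdge.tgt, BlockNode.depth]
    exact lt_irrefl _ (key v hv)

/-- `N₁(m)`: one block `B(m)` with inputs `x₀, …, xₘ`; the additional receiver receives all the
output edges and demands `x₀`. -/
abbrev N1 (m : ℕ) : Network :=
  blockNetwork (ι := Unit) (fun _ => m) (M := Fin (m + 1)) (fun _ j => j) (fun _ => Set.univ) 0

/-- `N₂(m, w)`: `w` blocks `B(m + 1)`, whose `0`th input is the shared message `z` (here `none`)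
and whose other inputs are messages `x^(l)₁, …, x^(l)ₘ₊₁` of their own; the additional receiver
receives all the output edges but the `0`th ones and demands `z`. -/
abbrev N2 (m w : ℕ) : Network :=
  blockNetwork (ι := Fin w) (fun _ => m + 1) (M := Option (Fin w × Fin (m + 1)))
    (fun l => Fin.cases none fun j => some (l, j)) (fun _ => {i | i ≠ 0}) none

/-- `N₃(m₁, m₂)`: blocks `B(m₁)` and `B(m₂)`, whose `0`th input is the shared message `z` (here
`none`) and whose other inputs are messages `x^(l)₁, …, x^(l)_{m_l}` of their own; the additional
receiver receives all the output edges of both blocks and demands `z`. -/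
abbrev N3 (m₁ m₂ : ℕ) : Network :=
  blockNetwork (ι := Fin 2) ![m₁, m₂] (M := Option (Σ l : Fin 2, Fin (![m₁, m₂] l)))
    (fun l => Fin.cases none fun j => some ⟨l, j⟩) (fun _ => Set.univ) none

/-- `f(m) = ∏ p ^ (γ_p - 1)` over the primes `p ∣ m`, where `γ_p` is the exponent of `p` in `m`. -/
def fN4 (m : ℕ) : ℕ := ∏ p ∈ m.primeFactors, p ^ (m.factorization p - 1)

/-- `μ(m, p)`, the least `α ≥ 0` with `p ^ α ≥ f(m)`. -/
noncomputable def muN4 (m p : ℕ) : ℕ := sInf {α | fN4 m ≤ p ^ α}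

/-- `g(m, p) = p ^ (γ_p - 1) * ∏ q ^ μ(m, q)`, over the primes `q ∣ m` other than `p`. -/
noncomputable def gN4 (m p : ℕ) : ℕ :=
  p ^ (m.factorization p - 1) * ∏ q ∈ m.primeFactors.erase p, q ^ muN4 m q

/-- `N₄(m)`: the disjoint union of the networks `N₁(q)` for the primes `q < f(m)` not dividing `m`,
the networks `N₂(p ^ γ_p, m / p ^ γ_p)` for the primes `p ∣ m`, and the networks `N₃(p, g(m, p))`
for the primes `p ∣ m` with `γ_p > 1`. -/
noncomputable def N4 (m : ℕ) : Network :=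
  disjointUnion
    (ι := {q // q ∈ (Finset.range (fN4 m)).filter fun q => q.Prime ∧ ¬ q ∣ m} ⊕
      {p // p ∈ m.primeFactors} ⊕
      {p // p ∈ m.primeFactors.filter fun p => 1 < m.factorization p})
    (Sum.elim (fun q => N1 q.1)
      (Sum.elim (fun p => N2 (p.1 ^ m.factorization p.1) (m / p.1 ^ m.factorization p.1))
        (fun p => N3 p.1 (gN4 m p.1))))

end Network

/-! In a block only the value `P i` on uᵢ → vᵢ, which is blind to the i-th input, and the value `Q`
on u → v matter. Together they must determine the i-th input, and the `P i` sent to the extra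
receiver must determine its demand.

Capacity: since `P i` is blind to input i, `Q` is injective in that input, so k ≤ n. For a scalar
solution over an alphabet of size m, label the inputs by elements of an abelian group, let `Q` be
their sum and `P i` the sum without the i-th term (`isScalarSolvable_blockNetwork`). If two message
tuples look alike to the extra receiver, the differences of the inputs that reach it all equal the
total difference D. This gives a linear relation which, for a suitable group and suitable, possibly
nonlinear, labellings, forces equal demands.

Linear codes: write `B j` for `Q` restricted to input j. At rate 1 every `B j` would be invertible,
and the inputs yⱼ = aⱼ Bⱼ⁻¹ B₀ ζ with ∑ aⱼ = aᵢ for every output i would be invisible to the extra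
receiver although the demand is ζ. Near rate 1 this fails only by dimensions proportional to n - k,
whence `IsBlockCode.finrank_le`. Such coefficients exist for `N2 m w` if m ≠ 0 in the field and for
`N3 m₁ m₂` if m₁ = m₂ = 0 there. For composite m every field meets one of these cases among the
components (`exists_prime_factor_cast`). -/

namespace Network

/-! ### Solutions as flows, without edge and decoding functions -/

/-- An assignment of edge values to message values is a flow if the value of every edge, and every
demand of every node, is determined by the inputs of the corresponding node. -/
structure IsFlow (N : Network) {Y Z : Type*} (val : (N.Msg → Y) → N.Edge → Z) : Prop where
  edge : ∀ e x x', (∀ y, N.origin y = N.src e → x y = x' y) →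
    (∀ f, N.tgt f = N.src e → val x f = val x' f) → val x e = val x' e
  demand : ∀ v, ∀ d ∈ N.demands v, ∀ x x', (∀ y, N.origin y = v → x y = x' y) →
    (∀ f, N.tgt f = v → val x f = val x' f) → x d = x' d

theorem Code.inputs_congr {N : Network} {A : Type u} {k n : ℕ} (c : N.Code A k n) {v : N.Node}
    {x x' : N.Msg → Fin k → A} (hx : ∀ y, N.origin y = v → x y = x' y)
    (hf : ∀ f, N.tgt f = v → c.edgeSymbol x f = c.edgeSymbol x' f) :
    c.inputs x v = c.inputs x' v :=
  Prod.ext (funext fun y => hx y.1 y.2) (funext fun f => hf f.1 f.2)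

theorem Code.IsSolution.isFlow {N : Network} {A : Type u} {k n : ℕ} {c : N.Code A k n}
    (hc : c.IsSolution) : N.IsFlow c.edgeSymbol where
  edge e x x' hx hf := by
    rw [c.edgeSymbol_eq, c.edgeSymbol_eq, c.inputs_congr hx hf]
  demand v d hd x x' hx hf := by
    rw [← hc x v ⟨d, hd⟩, ← hc x' v ⟨d, hd⟩, c.inputs_congr hx hf]

theorem IsFlow.exists_solution {N : Network} {A : Type u} [Nonempty A] {k n : ℕ}
    {val : (N.Msg → Fin k → A) → N.Edge → Fin n → A} (h : N.IsFlow val) :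
    ∃ c : N.Code A k n, c.IsSolution := by
  classical
  obtain ⟨a⟩ := ‹Nonempty A›
  let inp : ∀ v, (N.Msg → Fin k → A) → N.Inputs A k n v :=
    fun v x => (fun y => x y.1, fun f => val x f.1)
  have hinp : ∀ v x x', inp v x = inp v x' →
      (∀ y, N.origin y = v → x y = x' y) ∧ ∀ f, N.tgt f = v → val x f = val x' f := by
    intro v x x' hxx
    exact ⟨fun y hy => congrFun (congrArg Prod.fst hxx) ⟨y, hy⟩,
      fun f hf => congrFun (congrArg Prod.snd hxx) ⟨f, hf⟩⟩
  -- The constant `a` only fills in inputs that no choice of messages produces.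
  let c : N.Code A k n :=
    { edgeFn := fun e => Function.extend (inp (N.src e)) (fun x => val x e) fun _ _ => a
      decode := fun v d => Function.extend (inp v) (fun x => x d.1) fun _ _ => a }
  have hval : ∀ x e, c.edgeSymbol x e = val x e := by
    intro x e
    induction e using N.wellFounded_edge.induction with
    | _ e ih =>
      have hi : c.inputs x (N.src e) = inp (N.src e) x :=
        Prod.ext rfl (funext fun f => ih f.1 f.2)
      have hfac : Function.FactorsThrough (fun x => val x e) (inp (N.src e)) := fun x x' hxx =>
        h.edge e x x' (hinp _ x x' hxx).1 (hinp _ x x' hxx).2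
      rw [c.edgeSymbol_eq, hi]
      exact hfac.extend_apply (fun _ _ => a) x
  refine ⟨c, fun x v d => ?_⟩
  have hi : c.inputs x v = inp v x := Prod.ext rfl (funext fun f => hval x f.1)
  have hfac : Function.FactorsThrough (fun x : N.Msg → Fin k → A => x d.1) (inp v) :=
    fun x x' hxx => h.demand v d.1 d.2 x x' (hinp _ x x' hxx).1 (hinp _ x x' hxx).2
  rw [hi]
  exact hfac.extend_apply (fun _ _ => a) x

theorem IsLinearFn.map_add {N : Network} {F : Type u} [Ring F] {k n r : ℕ} {v : N.Node}
    {φ : N.Inputs F k n v → Fin r → F} (h : IsLinearFn φ) (s t : N.Inputs F k n v) :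
    φ (s + t) = φ s + φ t := by
  obtain ⟨M, M', h⟩ := h
  simp only [h, Prod.fst_add, Prod.snd_add, Pi.add_apply, Matrix.mulVec_add,
    Finset.sum_add_distrib]
  abel

theorem IsLinearFn.map_smul {N : Network} {F : Type u} [CommRing F] {k n r : ℕ} {v : N.Node}
    {φ : N.Inputs F k n v → Fin r → F} (h : IsLinearFn φ) (a : F) (s : N.Inputs F k n v) :
    φ (a • s) = a • φ s := by
  obtain ⟨M, M', h⟩ := h
  simp only [h, Prod.smul_fst, Prod.smul_snd, Pi.smul_apply, Matrix.mulVec_smul,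
    smul_add, Finset.smul_sum]

theorem Code.IsLinear.isLinearMap_edgeSymbol {N : Network} {F : Type u} [CommRing F] {k n : ℕ}
    {c : N.Code F k n} (hc : c.IsLinear) (e : N.Edge) :
    IsLinearMap F fun x => c.edgeSymbol x e := by
  induction e using N.wellFounded_edge.induction with
  | _ e ih =>
    constructor
    · intro x y
      have : c.inputs (x + y) (N.src e) = c.inputs x (N.src e) + c.inputs y (N.src e) :=
        Prod.ext rfl (funext fun f => (ih f.1 f.2).map_add x y)
      rw [c.edgeSymbol_eq, c.edgeSymbol_eq, c.edgeSymbol_eq, this, (hc.1 e).map_add]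
    · intro a x
      have : c.inputs (a • x) (N.src e) = a • c.inputs x (N.src e) :=
        Prod.ext rfl (funext fun f => (ih f.1 f.2).map_smul a x)
      rw [c.edgeSymbol_eq, c.edgeSymbol_eq, this, (hc.1 e).map_smul]

section DisjointUnion

variable {ι : Type} [Finite ι] {N : ι → Network}

theorem IsFlow.component {Y Z : Type*} {val : ((disjointUnion N).Msg → Y) → (Σ i, (N i).Edge) → Z}
    (h : (disjointUnion N).IsFlow val) (i : ι) (x₀ : (disjointUnion N).Msg → Y) :
    (N i).IsFlow fun x e => val (Function.extend (Sigma.mk i) x x₀) ⟨i, e⟩ where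
  edge e x x' hx hf := by
    refine h.edge ⟨i, e⟩ _ _ ?_ ?_
    · rintro ⟨j, y⟩ hy
      obtain ⟨rfl, hy⟩ := Sigma.mk.inj_iff.1 hy
      simp only [sigma_mk_injective.extend_apply]
      exact hx y (eq_of_heq hy)
    · rintro ⟨j, f⟩ hy
      obtain ⟨rfl, hy⟩ := Sigma.mk.inj_iff.1 hy
      exact hf f (eq_of_heq hy)
  demand v d hd x x' hx hf := by
    have := h.demand ⟨i, v⟩ ⟨i, d⟩ ⟨d, hd, rfl⟩ (Function.extend (Sigma.mk i) x x₀)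
      (Function.extend (Sigma.mk i) x' x₀) ?_ ?_
    · simpa only [sigma_mk_injective.extend_apply] using this
    · rintro ⟨j, y⟩ hy
      obtain ⟨rfl, hy⟩ := Sigma.mk.inj_iff.1 hy
      simp only [sigma_mk_injective.extend_apply]
      exact hx y (eq_of_heq hy)
    · rintro ⟨j, f⟩ hy
      obtain ⟨rfl, hy⟩ := Sigma.mk.inj_iff.1 hy
      exact hf f (eq_of_heq hy)

theorem IsFlow.disjointUnion {Y Z : Type*} {val : ∀ i, ((N i).Msg → Y) → (N i).Edge → Z}
    (h : ∀ i, (N i).IsFlow (val i)) :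
    (disjointUnion N).IsFlow fun x e => val e.1 (fun y => x ⟨e.1, y⟩) e.2 where
  edge := by
    rintro ⟨i, e⟩ x x' hx hf
    exact (h i).edge e _ _ (fun y hy => hx ⟨i, y⟩ (congrArg (Sigma.mk i) hy))
      fun f hf' => hf ⟨i, f⟩ (congrArg (Sigma.mk i) hf')
  demand := by
    rintro ⟨i, v⟩ _ ⟨d, hd, rfl⟩ x x' hx hf
    exact (h i).demand v d hd _ _ (fun y hy => hx ⟨i, y⟩ (congrArg (Sigma.mk i) hy))
      fun f hf' => hf ⟨i, f⟩ (congrArg (Sigma.mk i) hf')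

end DisjointUnion

/-- The edge values are linear in the messages. -/
def IsLinearFlow (N : Network) (F : Type u) [Semiring F] (k n : ℕ) : Prop :=
  ∃ val : (N.Msg → Fin k → F) → N.Edge → Fin n → F,
    N.IsFlow val ∧ ∀ e, IsLinearMap F fun x => val x e

theorem Code.IsLinear.isLinearFlow {N : Network} {F : Type u} [CommRing F] {k n : ℕ}
    {c : N.Code F k n} (hl : c.IsLinear) (hs : c.IsSolution) : N.IsLinearFlow F k n :=
  ⟨_, hs.isFlow, hl.isLinearMap_edgeSymbol⟩

theorem IsLinearFlow.component {ι : Type} [Finite ι] {N : ι → Network} {F : Type u} [Semiring F]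
    {k n : ℕ} (h : (Network.disjointUnion N).IsLinearFlow F k n) (i : ι) :
    (N i).IsLinearFlow F k n := by
  obtain ⟨val, hv, hl⟩ := h
  refine ⟨_, hv.component i 0, fun e => ⟨fun x y => ?_, fun a x => ?_⟩⟩
  · rw [← (hl _).map_add, ← Function.extend_add, add_zero]
  · rw [← (hl _).map_smul, ← Function.extend_smul, smul_zero]

end Network

/-! ### Block networks reduced to the values on uᵢ → vᵢ and u → v -/

namespace Network

section Block

variable {ι : Type} {b : ι → ℕ} {M : Type} {Y Z : Type*}

/-- The conditions for `P l i` and `Q l` to be the values carried by the edges `uᵢ → vᵢ` and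
`u → v` of block `l` in a solution of a network made of blocks. -/
structure IsBlockCode (inp : ∀ l, Fin (b l + 1) → M) (out : ∀ l, Set (Fin (b l + 1))) (z : M)
    (P : ∀ l, Fin (b l + 1) → (M → Y) → Z) (Q : ι → (M → Y) → Z) : Prop where
  congr_at : ∀ l i x x', (∀ j ≠ i, x (inp l j) = x' (inp l j)) → P l i x = P l i x'
  congr_all : ∀ l x x', (∀ j, x (inp l j) = x' (inp l j)) → Q l x = Q l x'
  receiver : ∀ l i x x', P l i x = P l i x' → Q l x = Q l x' → x (inp l i) = x' (inp l i)
  extra : ∀ x x', (∀ l, ∀ i ∈ out l, P l i x = P l i x') → x z = x' z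

variable {inp : ∀ l, Fin (b l + 1) → M} {out : ∀ l, Set (Fin (b l + 1))} {z : M}

-- `P l i` does not see input i, so `Q l` alone must distinguish its values once the other inputs
-- are fixed.
open scoped Classical in
theorem IsBlockCode.injective_update {P : ∀ l, Fin (b l + 1) → (M → Y) → Z}
    {Q : ι → (M → Y) → Z} (h : IsBlockCode inp out z P Q) {l : ι}
    (hl : Function.Injective (inp l)) (i : Fin (b l + 1)) (x : M → Y) :
    Function.Injective fun y => Q l (Function.update x (inp l i) y) := by
  intro y y' hy
  have := h.receiver l i _ _ (h.congr_at l i (Function.update x (inp l i) y)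
    (Function.update x (inp l i) y') fun j hj => ?_) hy
  · simpa using this
  · rw [Function.update_of_ne (hl.ne hj), Function.update_of_ne (hl.ne hj)]

variable [Finite ι] [Finite M]

/-- An edge leaving a source depends on one message only, and an edge leaving vᵢ or v on a single
incoming edge. Hence nothing is lost by keeping only the edges u → v. -/
theorem IsFlow.isBlockCode {val : (M → Y) → BlockEdge ι b out → Z}
    (h : (blockNetwork b inp out z).IsFlow val) :
    IsBlockCode inp out z (fun l i x => val x (.uv l i)) (fun l x => val x (.uvAll l)) := by
  have hU : ∀ l i j hj x x', x (inp l j) = x' (inp l j) →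
      val x (.sourceU l i j hj) = val x' (.sourceU l i j hj) := by
    intro l i j hj x x' hx
    refine h.edge (.sourceU l i j hj) x x' (fun y hy => ?_) (fun f hf => ?_)
    · obtain rfl : y = inp l j := BlockNode.source.inj hy
      exact hx
    · cases f <;> cases hf
  have hA : ∀ l j x x', x (inp l j) = x' (inp l j) →
      val x (.sourceUAll l j) = val x' (.sourceUAll l j) := by
    intro l j x x' hx
    refine h.edge (.sourceUAll l j) x x' (fun y hy => ?_) (fun f hf => ?_)
    · obtain rfl : y = inp l j := BlockNode.source.inj hy
      exact hx
    · cases f <;> cases hf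
  constructor
  · intro l i x x' hx
    refine h.edge (.uv l i) x x' (fun y hy => by cases hy) (fun f hf => ?_)
    cases f <;> cases hf
    exact hU _ _ _ _ _ _ (hx _ ‹_›)
  · intro l x x' hx
    refine h.edge (.uvAll l) x x' (fun y hy => by cases hy) (fun f hf => ?_)
    cases f <;> cases hf
    exact hA _ _ _ _ (hx _)
  · intro l i x x' hP hQ
    refine h.demand (.receiver l i) (inp l i) rfl x x' (fun y hy => by cases hy) (fun f hf => ?_)
    cases f <;> cases hf
    · refine h.edge (.vReceiver l i) x x' (fun y hy => by cases hy) (fun f hf => ?_)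
      cases f <;> cases hf
      exact hP
    · refine h.edge (.vAllReceiver l i) x x' (fun y hy => by cases hy) (fun f hf => ?_)
      cases f <;> cases hf
      exact hQ
  · intro x x' hP
    refine h.demand .extra z rfl x x' (fun y hy => by cases hy) (fun f hf => ?_)
    cases f <;> cases hf
    rename_i l i hi
    refine h.edge (.output l i hi) x x' (fun y hy => by cases hy) (fun f hf => ?_)
    cases f <;> cases hf
    exact hP _ _ hi

theorem IsBlockCode.exists_isFlow {P : ∀ l, Fin (b l + 1) → (M → Y) → Y} {Q : ι → (M → Y) → Y}
    (h : IsBlockCode inp out z P Q) :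
    ∃ val : (M → Y) → BlockEdge ι b out → Y, (blockNetwork b inp out z).IsFlow val := by
  let val : (M → Y) → BlockEdge ι b out → Y := fun x e => match e with
    | .sourceU l _ j _ => x (inp l j)
    | .sourceUAll l j => x (inp l j)
    | .uv l i => P l i x
    | .uvAll l => Q l x
    | .vReceiver l i => P l i x
    | .vAllReceiver l _ => Q l x
    | .output l i _ => P l i x
  refine ⟨val, fun e x x' hx hf => ?_, fun v d hd x x' hx hf => ?_⟩
  · cases e with
    | sourceU l i j hj => exact hx _ rfl
    | sourceUAll l j => exact hx _ rfl
    | uv l i => exact h.congr_at l i x x' fun j hj => hf (.sourceU l i j hj) rfl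
    | uvAll l => exact h.congr_all l x x' fun j => hf (.sourceUAll l j) rfl
    | vReceiver l i => exact hf (.uv l i) rfl
    | vAllReceiver l i => exact hf (.uvAll l) rfl
    | output l i hi => exact hf (.uv l i) rfl
  · cases v with
    | receiver l i =>
      have hd : d = inp l i := hd
      rw [hd]
      exact h.receiver l i x x' (hf (.vReceiver l i) rfl) (hf (.vAllReceiver l i) rfl)
    | extra =>
      have hd : d = z := hd
      rw [hd]
      exact h.extra x x' fun l i hi => hf (.output l i hi) rfl
    | _ => exact absurd hd (Set.notMem_empty _)

end Block

end Network

/-! ### Dimension counts for injective maps of small corank -/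

section LinearAlgebra

open Module

variable {F V W Y Z : Type*} [Field F] [AddCommGroup V] [Module F V] [AddCommGroup W] [Module F W]
  [AddCommGroup Y] [Module F Y] [AddCommGroup Z] [Module F Z]

theorem Submodule.finrank_le_finrank_iInf_add [FiniteDimensional F V] {α : Type*} (s : Finset α)
    (S : α → Submodule F V) {d : ℕ} (h : ∀ a ∈ s, finrank F V ≤ finrank F (S a) + d) :
    finrank F V ≤ finrank F (⨅ a ∈ s, S a : Submodule F V) + s.card * d := by
  classical
  induction s using Finset.induction_on with
  | empty =>
    have h0 : (⨅ a ∈ (∅ : Finset α), S a) = ⊤ := by simp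
    rw [h0, finrank_top]
    exact Nat.le_add_right _ _
  | insert a s ha ih =>
    have h1 := h a (Finset.mem_insert_self a s)
    have h2 := ih fun c hc => h c (Finset.mem_insert_of_mem hc)
    have h3 := Submodule.finrank_sup_add_finrank_inf_eq (S a) (⨅ a ∈ s, S a)
    have h4 := Submodule.finrank_le (S a ⊔ ⨅ a ∈ s, S a)
    rw [Finset.iInf_insert, Finset.card_insert_of_notMem ha, add_mul]
    omega

/-- The preimage is isomorphic to the intersection of the two ranges, which are subspaces of `Z` of
dimension dim Y. -/
theorem LinearMap.two_mul_finrank_le_finrank_comap_range [FiniteDimensional F Y]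
    [FiniteDimensional F Z] {f g : Y →ₗ[F] Z} (hf : Function.Injective f)
    (hg : Function.Injective g) :
    2 * finrank F Y ≤ finrank F (g.range.comap f) + finrank F Z := by
  have h1 : finrank F ((g.range.comap f).map f) = finrank F (g.range.comap f) :=
    LinearEquiv.finrank_eq (Submodule.equivMapOfInjective f hf _).symm
  rw [Submodule.map_comap_eq] at h1
  have h2 := Submodule.finrank_sup_add_finrank_inf_eq f.range g.range
  have h3 := Submodule.finrank_le (f.range ⊔ g.range)
  rw [LinearMap.finrank_range_of_inj hf, LinearMap.finrank_range_of_inj hg] at h2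
  omega

/-- If `S (C u) = S (B v)` forces `v = 0` as soon as `T (C u) ∈ T(K)`, then the image of `K` under
`T` is small. -/
theorem Submodule.finrank_map_le_of_separated [FiniteDimensional F Y] [FiniteDimensional F Z]
    {S T : V →ₗ[F] Z} {B C : Y →ₗ[F] V} (hB : Function.Injective (S ∘ₗ B))
    (hC : Function.Injective (S ∘ₗ C)) (K : Submodule F V)
    (h : ∀ x ∈ K, ∀ u v, T (C u) = T x → S (C u) = S (B v) → v = 0) :
    finrank F (K.map T) + 2 * finrank F Y ≤ 2 * finrank F Z := by
  -- On `U` the map `T ∘ₗ C` is injective with image meeting `K.map T` trivially, so both fit side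
  -- by side in `Z`; and dim U ≥ 2 dim Y - dim Z.
  set U := (S ∘ₗ B).range.comap (S ∘ₗ C)
  have hU : 2 * finrank F Y ≤ finrank F U + finrank F Z :=
    LinearMap.two_mul_finrank_le_finrank_comap_range hC hB
  have key : ∀ u ∈ U, T (C u) ∈ K.map T → u = 0 := by
    rintro u ⟨v, hv⟩ ⟨x, hx, hxu⟩
    have hv0 : v = 0 := h x hx u v hxu.symm hv.symm
    refine hC ?_
    rw [← hv, hv0, map_zero, map_zero]
  have hinj : Function.Injective ((T ∘ₗ C).domRestrict U) := by
    rw [← LinearMap.ker_eq_bot, LinearMap.ker_eq_bot']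
    rintro ⟨u, hu⟩ hu0
    refine Subtype.ext (key u hu ?_)
    have : T (C u) = 0 := hu0
    rw [this]
    exact zero_mem _
  have hdisj : K.map T ⊓ ((T ∘ₗ C).domRestrict U).range = ⊥ := by
    rw [eq_bot_iff]
    rintro w ⟨hw, ⟨⟨u, hu⟩, rfl⟩⟩
    have hw' : T (C u) ∈ K.map T := hw
    have : u = 0 := key u hu hw'
    subst this
    simp
  have h1 := Submodule.finrank_sup_add_finrank_inf_eq (K.map T) ((T ∘ₗ C).domRestrict U).range
  have h2 := Submodule.finrank_le (K.map T ⊔ ((T ∘ₗ C).domRestrict U).range)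
  rw [hdisj, finrank_bot, LinearMap.finrank_range_of_inj hinj] at h1
  omega

end LinearAlgebra

/-! ### Rate bound for linear block codes -/

namespace Network

open Module

section Block

variable {ι : Type} {b : ι → ℕ} {M : Type} {F Y Z : Type*} [Field F]
  [AddCommGroup Y] [Module F Y] [AddCommGroup Z] [Module F Z]
  {inp : ∀ l, Fin (b l + 1) → M} {out : ∀ l, Set (Fin (b l + 1))}
  {z : M} {P : ∀ l, Fin (b l + 1) → (M → Y) →ₗ[F] Z} {Q : ι → (M → Y) →ₗ[F] Z}

open scoped Classical in
theorem IsBlockCode.injective_comp_single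
    (h : IsBlockCode inp out z (fun l i x => P l i x) (fun l x => Q l x)) {l : ι}
    (hl : Function.Injective (inp l)) (i : Fin (b l + 1)) :
    Function.Injective (Q l ∘ₗ LinearMap.single F (fun _ => Y) (inp l i)) :=
  h.injective_update hl i 0

open scoped Classical in
theorem IsBlockCode.map_eq_sum
    (h : IsBlockCode inp out z (fun l i x => P l i x) (fun l x => Q l x)) {l : ι}
    (hl : Function.Injective (inp l)) (x : M → Y) :
    Q l x = ∑ j, (Q l ∘ₗ LinearMap.single F (fun _ => Y) (inp l j)) (x (inp l j)) := by
  simp only [LinearMap.comp_apply]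
  rw [← map_sum]
  refine h.congr_all l _ _ fun j => ?_
  rw [Finset.sum_apply, Finset.sum_eq_single j]
  · simp
  · intro i _ hi
    simp [Pi.single_eq_of_ne (hl.ne hi.symm)]
  · simp

/-- To resolve input i, `P l i` must retain almost all of input j. This leaves little room for the
vectors that have zero i-th input and are killed by `Q l`: at rate 1 their image under `P l i` is
zero. -/
theorem IsBlockCode.finrank_map_le [FiniteDimensional F Y] [FiniteDimensional F Z]
    (h : IsBlockCode inp out z (fun l i x => P l i x) (fun l x => Q l x)) {l : ι}
    (hl : Function.Injective (inp l)) {i j : Fin (b l + 1)} (hij : j ≠ i) :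
    finrank F (((LinearMap.proj (inp l i)).ker ⊓ (Q l).ker).map (P l i)) + 2 * finrank F Y ≤
      2 * finrank F Z := by
  classical
  refine Submodule.finrank_map_le_of_separated (h.injective_comp_single hl i)
    (h.injective_comp_single hl j) _ ?_
  rintro x ⟨hx, hQx⟩ u v hP hQ
  have hx0 : x (inp l i) = 0 := hx
  have hQ0 : Q l x = 0 := hQx
  have hne : inp l i ≠ inp l j := hl.ne hij.symm
  have hPv : P l i (Pi.single (inp l i) v) = P l i 0 :=
    h.congr_at l i _ _ fun j hj => by simp [Pi.single_eq_of_ne (hl.ne hj)]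
  -- The receiver cannot tell u at input j and -v at input i from `x`: `Q l` is zero on both, and `P
  -- l i` ignores v. As `x` vanishes at input i, so does v.
  have := h.receiver l i
    (LinearMap.single F (fun _ => Y) (inp l j) u - LinearMap.single F (fun _ => Y) (inp l i) v) x
    (by simp only [map_sub, LinearMap.coe_single] at *; rw [hP, hPv]; simp)
    (by simp only [map_sub, hQ, hQ0, sub_self])
  simpa [hx0, Pi.single_eq_of_ne hne] using this

/-- A rate bound for linear codes: if there are coefficients `a l j` with `a l 0 = 1` such that
`∑ j, a l j = a l i` whenever the `i`th output of block `l` reaches the additional receiver, then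
messages proportional to these coefficients are nearly invisible to that receiver. -/
theorem IsBlockCode.finrank_le [Fintype ι] [FiniteDimensional F Y] [FiniteDimensional F Z]
    (h : IsBlockCode inp out z (fun l i x => P l i x) (fun l x => Q l x))
    (hinp : ∀ l, Function.Injective (inp l)) (hb : ∀ l, b l ≠ 0) (l₀ : ι)
    (hz : ∀ l, inp l 0 = z) (r : M → Σ l, Fin (b l + 1)) (hrz : r z = ⟨l₀, 0⟩)
    (hr : ∀ l j, j ≠ 0 → r (inp l j) = ⟨l, j⟩)
    (a : ∀ l, Fin (b l + 1) → F) (ha0 : ∀ l, a l 0 = 1)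
    (ha : ∀ l, ∀ i ∈ out l, ∑ j, a l j = a l i) :
    finrank F Y ≤ finrank F Z ∧
    finrank F Y ≤ 3 * (∑ l, (b l + 1)) * (finrank F Z - finrank F Y) := by
  classical
  have hle : finrank F Y ≤ finrank F Z :=
    LinearMap.finrank_le_finrank_of_injective (h.injective_comp_single (hinp l₀) 0)
  refine ⟨hle, ?_⟩
  obtain ⟨δ, hδ⟩ := Nat.exists_eq_add_of_le hle
  let B : ∀ l, Fin (b l + 1) → Y →ₗ[F] Z :=
    fun l j => Q l ∘ₗ LinearMap.single F (fun _ => Y) (inp l j)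
  have hB : ∀ l j, Function.Injective (B l j) := fun l j => h.injective_comp_single (hinp l) j
  have hL : ∀ l j, ∃ g : Z →ₗ[F] Y, g ∘ₗ B l j = LinearMap.id := fun l j =>
    LinearMap.exists_leftInverse_of_injective _ (LinearMap.ker_eq_bot.2 (hB l j))
  choose L hL using hL
  -- The left inverse `L` replaces Bⱼ⁻¹ in aⱼ Bⱼ⁻¹ B₀; it is exact only on vectors ζ with B₀ ζ in
  -- the range of Bⱼ.
  let H : (Σ l, Fin (b l + 1)) → Y →ₗ[F] Y := fun s => a s.1 s.2 • (L s.1 s.2 ∘ₗ B s.1 0)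
  have hH0 : ∀ l, H ⟨l, 0⟩ = LinearMap.id := fun l => by simp [H, hL, ha0]
  -- The blocks agree on the shared message because `a l 0 = 1` makes its value ζ in each of them.
  let X : Y →ₗ[F] (M → Y) := LinearMap.pi fun y => H (r y)
  have hXz : ∀ ζ, X ζ z = ζ := fun ζ => by simp [X, hrz, hH0]
  have hX : ∀ l j ζ, X ζ (inp l j) = H ⟨l, j⟩ ζ := by
    intro l j ζ
    by_cases hj : j = 0
    · rw [hj, hz, hXz, hH0]; rfl
    · simp [X, hr l j hj]
  let J : Finset (Σ l, Fin (b l + 1)) := Finset.univ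
  have hJ : J.card = ∑ l, (b l + 1) := by simp [J]
  -- On `S` all left inverses are exact; each condition costs at most δ dimensions.
  let S : Submodule F Y := ⨅ s ∈ J, (B s.1 s.2).range.comap (B s.1 0)
  have hS : finrank F Y ≤ finrank F S + J.card * δ := by
    refine Submodule.finrank_le_finrank_iInf_add J _ fun s _ => ?_
    have := LinearMap.two_mul_finrank_le_finrank_comap_range (hB s.1 0) (hB s.1 s.2)
    omega
  have hBX : ∀ ζ ∈ S, ∀ l j, B l j (X ζ (inp l j)) = a l j • B l 0 ζ := by
    intro ζ hζ l j
    have hm : ζ ∈ (B l j).range.comap (B l 0) :=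
      (Submodule.mem_iInf _).1 ((Submodule.mem_iInf _).1 hζ ⟨l, j⟩) (Finset.mem_univ _)
    obtain ⟨y, hy⟩ := hm
    have hLy : L l j (B l j y) = y := LinearMap.congr_fun (hL l j) y
    rw [hX]
    simp only [H, LinearMap.smul_apply, LinearMap.comp_apply, map_smul]
    rw [← hy, hLy]
  have hPX : ∀ ζ ∈ S, ∀ l, ∀ i ∈ out l,
      P l i (X ζ) ∈ ((LinearMap.proj (inp l i)).ker ⊓ (Q l).ker).map (P l i) := by
    intro ζ hζ l i hi
    -- Deleting input i does not change `P l i`, and it makes `Q l` vanish, since the whole sum of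
    -- coefficients equals `a l i`.
    refine ⟨X ζ - Pi.single (inp l i) (X ζ (inp l i)), ⟨?_, ?_⟩, ?_⟩
    · simp
    · have h1 : Q l (X ζ) = a l i • B l 0 ζ := by
        rw [h.map_eq_sum (hinp l), ← ha l i hi, Finset.sum_smul]
        exact Finset.sum_congr rfl fun j _ => hBX ζ hζ l j
      have h2 : Q l (Pi.single (inp l i) (X ζ (inp l i))) = a l i • B l 0 ζ := hBX ζ hζ l i
      change Q l _ = 0
      rw [map_sub, h1, h2, sub_self]
    · exact h.congr_at l i _ _ fun j hj => by simp [Pi.single_eq_of_ne ((hinp l).ne hj)]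
  let J' := J.filter fun s => s.2 ∈ out s.1
  -- Vectors of `T` look like zero to the extra receiver, so `T` is trivial; each output costs at
  -- most 2δ, which with the δ for `S` gives the factor 3.
  let T : Submodule F S := ⨅ s ∈ J', ((P s.1 s.2 ∘ₗ X).domRestrict S).ker
  have hT : finrank F S ≤ finrank F T + J'.card * (2 * δ) := by
    refine Submodule.finrank_le_finrank_iInf_add J' _ fun s hs => ?_
    have hs' : s.2 ∈ out s.1 := (Finset.mem_filter.1 hs).2
    have h1 := LinearMap.finrank_range_add_finrank_ker ((P s.1 s.2 ∘ₗ X).domRestrict S)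
    have h2 : finrank F ((P s.1 s.2 ∘ₗ X).domRestrict S).range ≤ _ :=
      Submodule.finrank_mono (t := ((LinearMap.proj (inp s.1 s.2)).ker ⊓ (Q s.1).ker).map
        (P s.1 s.2)) (by rintro _ ⟨ζ, rfl⟩; exact hPX ζ.1 ζ.2 s.1 s.2 hs')
    have : Nontrivial (Fin (b s.1 + 1)) := Fin.nontrivial_iff_two_le.2 (by have := hb s.1; omega)
    obtain ⟨j, hj⟩ := exists_ne s.2
    have h3 := h.finrank_map_le (hinp s.1) hj
    omega
  have hT0 : T = ⊥ := by
    rw [eq_bot_iff]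
    intro ζ hζ
    have : X ζ.1 z = (0 : M → Y) z := h.extra _ _ fun l i hi => by
      have : ζ ∈ ((P l i ∘ₗ X).domRestrict S).ker :=
        (Submodule.mem_iInf _).1 ((Submodule.mem_iInf _).1 hζ ⟨l, i⟩)
          (Finset.mem_filter.2 ⟨Finset.mem_univ _, hi⟩)
      rw [map_zero]
      exact this
    rw [hXz] at this
    exact (Submodule.mem_bot _).2 (Subtype.ext this)
  rw [hT0, finrank_bot] at hT
  have hJ' : J'.card * (2 * δ) ≤ J.card * (2 * δ) :=
    Nat.mul_le_mul_right _ (Finset.card_filter_le _ _)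
  rw [← hJ, hδ, Nat.add_sub_cancel_left]
  linarith

end Block

end Network

/-! ### Scalar solutions from sums in abelian groups -/

namespace Network

/-- `N.IsScalarSolvable A`: the network has a solution over `A` in which messages and edges carry
one symbol each. -/
def IsScalarSolvable (N : Network) (A : Type*) : Prop :=
  ∃ val : (N.Msg → Fin 1 → A) → N.Edge → Fin 1 → A, N.IsFlow val

/-- Receiver i subtracts `P l i` from `Q l`. Two message tuples have the same `P l i` exactly when
the difference at input i equals the difference of the full sums, which is the premise of `hz`. -/
theorem isScalarSolvable_blockNetwork {ι : Type} [Finite ι] {b : ι → ℕ} {M : Type} [Finite M]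
    {inp : ∀ l, Fin (b l + 1) → M} {out : ∀ l, Set (Fin (b l + 1))} {z : M}
    {A G : Type*} [AddCommGroup G] (ψ : A ≃ G) (π : ∀ l, Fin (b l + 1) → A ≃ G)
    (hz : ∀ y y' : M → A, (∀ l, ∀ i ∈ out l, π l i (y (inp l i)) - π l i (y' (inp l i)) =
      ∑ j, (π l j (y (inp l j)) - π l j (y' (inp l j)))) → y z = y' z) :
    (blockNetwork b inp out z).IsScalarSolvable A := by
  classical
  refine IsBlockCode.exists_isFlow
    (P := fun l i x _ => ψ.symm (∑ j ∈ Finset.univ.erase i, π l j (x (inp l j) 0)))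
    (Q := fun l x _ => ψ.symm (∑ j, π l j (x (inp l j) 0))) ⟨?_, ?_, ?_, ?_⟩
  · intro l i x x' hx
    funext _
    exact congrArg _ (Finset.sum_congr rfl fun j hj => by rw [hx j (Finset.ne_of_mem_erase hj)])
  · intro l x x' hx
    funext _
    exact congrArg _ (Finset.sum_congr rfl fun j _ => by rw [hx j])
  · intro l i x x' hP hQ
    have hP := ψ.symm.injective (congrFun hP 0)
    have hQ := ψ.symm.injective (congrFun hQ 0)
    rw [Finset.sum_erase_eq_sub (Finset.mem_univ i), Finset.sum_erase_eq_sub (Finset.mem_univ i),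
      hQ, sub_right_inj] at hP
    funext t
    rw [Subsingleton.elim t 0]
    exact (π l i).injective hP
  · intro x x' hP
    funext t
    rw [Subsingleton.elim t 0]
    refine hz (fun y => x y 0) (fun y => x' y 0) fun l i hi => ?_
    have hP := ψ.symm.injective (congrFun (hP l i hi) 0)
    rw [Finset.sum_erase_eq_sub (Finset.mem_univ i), Finset.sum_erase_eq_sub (Finset.mem_univ i)]
      at hP
    rw [Finset.sum_sub_distrib]
    exact (sub_eq_sub_iff_sub_eq_sub.1 hP).symm

theorem isScalarSolvable_N1 {m q : ℕ} (h : q.Coprime m) : (N1 q).IsScalarSolvable (ZMod m) := by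
  refine isScalarSolvable_blockNetwork (Equiv.refl _) (fun _ _ => Equiv.refl (ZMod m)) ?_
  intro y y' hy
  have hy := fun i => hy () i (Set.mem_univ i)
  set D := ∑ j : Fin (q + 1), ((Equiv.refl (ZMod m)) (y j) - (Equiv.refl (ZMod m)) (y' j)) with hD
  have hsum : D = (q + 1) * D := by
    conv_lhs => rw [hD, Finset.sum_congr rfl fun i _ => hy i]
    simp
  have hq : (q : ZMod m) * D = 0 := by linear_combination -hsum
  have hu : IsUnit (q : ZMod m) := (ZMod.isUnit_iff_coprime q m).2 h
  rw [hu.mul_right_eq_zero] at hq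
  have := hy 0
  rw [hq] at this
  exact sub_eq_zero.1 this

theorem isScalarSolvable_N2 {m w : ℕ} (hm : 2 ≤ m) (hw : 0 < w) {A : Type*} [Finite A]
    (hA : Nat.card A = w * m) : (N2 m w).IsScalarSolvable A := by
  have : NeZero w := ⟨hw.ne'⟩
  have : NeZero m := ⟨by omega⟩
  have : Fact (1 < m) := ⟨hm⟩
  obtain ⟨ψ⟩ : Nonempty (A ≃ ZMod w × ZMod m) := Finite.card_eq.1 (by simp [hA])
  -- Each block reveals only the `ZMod m` component of its label of z. Block 0 leaves that component
  -- t unchanged; block l ≠ 0 adds 1 to it exactly when the other component s equals l. Together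
  -- they reveal t and then s, with s = 0 if nothing was added.
  let c : Fin w → ZMod w → ZMod m := fun l s => if l ≠ 0 ∧ s = (l : ℕ) then 1 else 0
  let σ : Fin w → ZMod w × ZMod m ≃ ZMod w × ZMod m := fun l =>
    Equiv.prodShear (Equiv.refl _) fun s => Equiv.addRight (c l s)
  refine isScalarSolvable_blockNetwork ψ
    (fun l => Fin.cases (ψ.trans (σ l)) fun _ => ψ) ?_
  intro y y' hy
  have key : ∀ l, (σ l (ψ (y none))).2 = (σ l (ψ (y' none))).2 := by
    intro l
    have hy := hy l
    simp only [Fin.sum_univ_succ (n := m + 1), Fin.cases_zero, Fin.cases_succ] at hy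
    set d₀ := (ψ.trans (σ l)) (y none) - (ψ.trans (σ l)) (y' none) with hd₀
    set D := d₀ + ∑ j : Fin (m + 1), (ψ (y (some (l, j))) - ψ (y' (some (l, j)))) with hD
    have h1 : ∀ j : Fin (m + 1), ψ (y (some (l, j))) - ψ (y' (some (l, j))) = D := fun j =>
      hy j.succ (Fin.succ_ne_zero j)
    have h2 : D.2 = d₀.2 + (m + 1) * D.2 := by
      conv_lhs => rw [hD, Finset.sum_congr rfl fun j _ => h1 j]
      simp
    rw [CharP.cast_eq_zero] at h2
    have h3 : d₀.2 = 0 := by linear_combination -h2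
    exact sub_eq_zero.1 h3
  refine ψ.injective ?_
  generalize ψ (y none) = p, ψ (y' none) = p' at key
  obtain ⟨s, t⟩ := p
  obtain ⟨s', t'⟩ := p'
  have key : ∀ l, t + c l s = t' + c l s' := key
  have ht : t = t' := by simpa [c] using key 0
  subst ht
  have hc : ∀ l, c l s = c l s' := fun l => add_left_cancel (key l)
  have aux : ∀ r r' : ZMod w, (∀ l, c l r = c l r') → r ≠ 0 → r = r' := by
    intro r r' h hr
    by_contra hne
    have h := h ⟨r.val, ZMod.val_lt r⟩
    have hr0 : (⟨r.val, ZMod.val_lt r⟩ : Fin w) ≠ 0 := fun h0 =>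
      hr ((ZMod.val_eq_zero r).1 (congrArg Fin.val h0))
    simp [c, hr0, Ne.symm hne] at h
  by_cases hs : s = 0
  · by_cases hs' : s' = 0
    · rw [hs, hs']
    · rw [aux s' s (fun l => (hc l).symm) hs']
  · rw [aux s s' hc hs]

theorem exists_digits_equiv {m : ℕ} (d₁ d₂ : ℕ) [NeZero d₁] [NeZero d₂] (hm : d₁ * d₂ = m) :
    ∃ e : Fin d₁ × Fin d₂ ≃ ZMod m, ∀ x, e x = ((x.1 + d₁ * x.2 : ℕ) : ZMod m) := by
  subst hm
  let g : Fin d₁ × Fin d₂ → ZMod (d₁ * d₂) := fun x => ((x.1 + d₁ * x.2 : ℕ) : ZMod (d₁ * d₂))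
  have hlt : ∀ x : Fin d₁ × Fin d₂, x.1.val + d₁ * x.2.val < d₁ * d₂ := fun x =>
    calc x.1.val + d₁ * x.2.val < d₁ * (x.2.val + 1) := by
          rw [mul_add, mul_one, add_comm]; exact Nat.add_lt_add_left x.1.2 _
      _ ≤ d₁ * d₂ := Nat.mul_le_mul_left _ x.2.2
  have hg : Function.Injective g := by
    intro x y hxy
    have h : x.1.val + d₁ * x.2.val = y.1.val + d₁ * y.2.val := by
      have := (ZMod.natCast_eq_natCast_iff' _ _ _).1 hxy
      rwa [Nat.mod_eq_of_lt (hlt x), Nat.mod_eq_of_lt (hlt y)] at this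
    have h1 : x.1.val = y.1.val := by
      have := congrArg (· % d₁) h
      simpa [Nat.add_mul_mod_self_left, Nat.mod_eq_of_lt] using this
    rw [h1, add_right_inj] at h
    exact Prod.ext (Fin.ext h1) (Fin.ext (Nat.eq_of_mul_eq_mul_left (Nat.pos_of_neZero d₁) h))
  exact ⟨Equiv.ofBijective g ((Nat.bijective_iff_injective_and_card g).2 ⟨hg, by simp⟩),
    fun _ => rfl⟩

theorem digits_fst_eq_of_dvd {m d₁ d₂ n : ℕ} (h : ∀ t : ℤ, (m : ℤ) ∣ n * t → (d₁ : ℤ) ∣ t)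
    {x x' : Fin d₁ × Fin d₂} (hx : (n : ZMod m) * (((x.1 + d₁ * x.2 : ℕ) : ZMod m) -
      ((x'.1 + d₁ * x'.2 : ℕ) : ZMod m)) = 0) : x.1 = x'.1 := by
  have h1 : (d₁ : ℤ) ∣ ((x.1 + d₁ * x.2 : ℕ) : ℤ) - ((x'.1 + d₁ * x'.2 : ℕ) : ℤ) := by
    refine h _ ((ZMod.intCast_zmod_eq_zero_iff_dvd _ _).1 ?_)
    push_cast at hx ⊢
    exact hx
  have h2 : (d₁ : ℤ) ∣ (x.1.val : ℤ) - (x'.1.val : ℤ) := by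
    have := dvd_sub h1 (Dvd.intro ((x.2.val : ℤ) - x'.2.val) rfl)
    refine this.trans (dvd_of_eq ?_)
    push_cast
    ring
  have h3 : x'.1.val % d₁ = x.1.val % d₁ := Nat.modEq_iff_dvd.2 h2
  rw [Nat.mod_eq_of_lt x.1.2, Nat.mod_eq_of_lt x'.1.2] at h3
  exact Fin.ext h3.symm

/-- Block l determines its label of z up to elements killed by its parameter, hence the lowest digit
of that label. The two blocks write z in mixed radix with opposite digit orders, so each reveals one
of the two digits. -/
theorem isScalarSolvable_N3 {m m₁ m₂ d₁ d₂ : ℕ} (hm : 0 < m) (hd : d₁ * d₂ = m)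
    (h₁ : ∀ t : ℤ, (m : ℤ) ∣ m₁ * t → (d₁ : ℤ) ∣ t)
    (h₂ : ∀ t : ℤ, (m : ℤ) ∣ m₂ * t → (d₂ : ℤ) ∣ t) {A : Type*} [Finite A]
    (hA : Nat.card A = m) : (N3 m₁ m₂).IsScalarSolvable A := by
  have : NeZero m := ⟨hm.ne'⟩
  have : NeZero d₁ := ⟨by rintro rfl; omega⟩
  have : NeZero d₂ := ⟨by rintro rfl; omega⟩
  obtain ⟨e₁, he₁⟩ := exists_digits_equiv d₁ d₂ hd
  obtain ⟨e₂, he₂⟩ := exists_digits_equiv d₂ d₁ ((mul_comm _ _).trans hd)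
  obtain ⟨α⟩ : Nonempty (A ≃ Fin d₁ × Fin d₂) := Finite.card_eq.1 (by simp [hA, hd])
  have ψ : A ≃ ZMod m := α.trans e₁
  let φ : Fin 2 → A ≃ ZMod m := ![α.trans e₁, (α.trans (Equiv.prodComm _ _)).trans e₂]
  refine isScalarSolvable_blockNetwork ψ (fun l => Fin.cases (φ l) fun _ => ψ) ?_
  intro y y' hy
  have key : ∀ l, ((![m₁, m₂] l : ℕ) : ZMod m) * (φ l (y none) - φ l (y' none)) = 0 := by
    intro l
    have hy := fun i => hy l i (Set.mem_univ i)
    set D := ∑ j, ((Fin.cases (φ l) (fun _ => ψ) j : A ≃ ZMod m) (y (Fin.cases none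
      (fun j => some ⟨l, j⟩) j)) - (Fin.cases (φ l) (fun _ => ψ) j : A ≃ ZMod m) (y' (Fin.cases none
      (fun j => some ⟨l, j⟩) j))) with hD
    have h0 : φ l (y none) - φ l (y' none) = D := hy 0
    have h1 : D = (![m₁, m₂] l + 1 : ℕ) * D := by
      conv_lhs => rw [hD, Finset.sum_congr rfl fun i _ => hy i]
      simp
    rw [h0]
    push_cast at h1
    linear_combination -h1
  have k₁ : (α (y none)).1 = (α (y' none)).1 := by
    refine digits_fst_eq_of_dvd h₁ ?_
    simpa only [φ, Matrix.cons_val_zero, Equiv.trans_apply, he₁] using key 0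
  have k₂ : (α (y none)).2 = (α (y' none)).2 := by
    refine digits_fst_eq_of_dvd (x := (α (y none)).swap) (x' := (α (y' none)).swap) h₂ ?_
    simpa only [φ, Matrix.cons_val_one, Matrix.cons_val_zero, Equiv.trans_apply, he₂, Equiv.coe_prodComm] using key 1
  exact α.injective (Prod.ext k₁ k₂)

end Network

/-! ### Bounds for the components, arithmetic of m, and assembly -/

namespace Network

theorem IsLinearFlow.isBlockCode {ι : Type} [Finite ι] {b : ι → ℕ} {M : Type} [Finite M]
    {inp : ∀ l, Fin (b l + 1) → M} {out : ∀ l, Set (Fin (b l + 1))} {z : M} {F : Type u} [Field F]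
    {k n : ℕ} (h : (blockNetwork b inp out z).IsLinearFlow F k n) :
    ∃ (P : ∀ l, Fin (b l + 1) → (M → Fin k → F) →ₗ[F] (Fin n → F))
      (Q : ι → (M → Fin k → F) →ₗ[F] (Fin n → F)),
      IsBlockCode inp out z (fun l i x => P l i x) (fun l x => Q l x) := by
  obtain ⟨val, hv, hl⟩ := h
  exact ⟨fun l i => (hl (.uv l i)).mk' _, fun l => (hl (.uvAll l)).mk' _, hv.isBlockCode⟩

theorem cases_none_injective {α : Type*} {n : ℕ} {f : Fin n → α} (hf : Function.Injective f) :
    Function.Injective (Fin.cases none fun j => some (f j) : Fin (n + 1) → Option α) := by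
  intro i j h
  induction i using Fin.cases <;> induction j using Fin.cases
  · rfl
  · cases h
  · cases h
  · exact congrArg Fin.succ (hf (Option.some.inj h))

theorem IsFlow.le_of_N2 {m w k n : ℕ} (hw : 0 < w) {A : Type*} [Finite A] [Nontrivial A]
    {val : ((N2 m w).Msg → Fin k → A) → (N2 m w).Edge → Fin n → A} (h : (N2 m w).IsFlow val) :
    k ≤ n := by
  classical
  obtain ⟨a⟩ := (inferInstance : Nonempty A)
  have hinj := h.isBlockCode.injective_update (l := ⟨0, hw⟩)
    (cases_none_injective (Prod.mk_right_injective _)) 0 fun _ _ => a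
  have hcard := Nat.card_le_card_of_injective _ hinj
  simp only [Nat.card_fun, Nat.card_fin] at hcard
  exact (Nat.pow_le_pow_iff_right Finite.one_lt_card).1 hcard

theorem IsLinearFlow.le_of_N2 {m w k n : ℕ} (hw : 0 < w) {F : Type u} [Field F]
    (hm : (m : F) ≠ 0) (h : (N2 m w).IsLinearFlow F k n) :
    k ≤ n ∧ k ≤ 3 * (w * (m + 2)) * (n - k) := by
  obtain ⟨P, Q, hPQ⟩ := h.isBlockCode
  have := hPQ.finrank_le (fun l => cases_none_injective (Prod.mk_right_injective l))
    (fun _ => Nat.succ_ne_zero m) ⟨0, hw⟩ (fun _ => rfl)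
    (fun y => y.elim ⟨⟨0, hw⟩, 0⟩ fun p => ⟨p.1, p.2.succ⟩) rfl
    (fun l j hj => by obtain ⟨j, rfl⟩ := Fin.exists_succ_eq.2 hj; rfl)
    -- Forced by 1 + (m + 1) a = a for the common value a at the outputs.
    (fun _ => Fin.cases 1 fun _ => -(m : F)⁻¹) (fun _ => rfl) ?_
  · simpa [add_assoc] using this
  · intro l i hi
    obtain ⟨i, rfl⟩ := Fin.exists_succ_eq.2 hi
    simp only [Fin.sum_univ_succ (n := m + 1), Fin.cases_zero, Fin.cases_succ, Finset.sum_const,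
      Finset.card_univ, Fintype.card_fin, nsmul_eq_mul]
    push_cast
    field_simp
    ring

theorem IsLinearFlow.le_of_N3 {m₁ m₂ k n : ℕ} (h₁ : m₁ ≠ 0) (h₂ : m₂ ≠ 0) {F : Type u} [Field F]
    (hF₁ : (m₁ : F) = 0) (hF₂ : (m₂ : F) = 0) (h : (N3 m₁ m₂).IsLinearFlow F k n) :
    k ≤ n ∧ k ≤ 3 * (m₁ + 1 + (m₂ + 1)) * (n - k) := by
  obtain ⟨P, Q, hPQ⟩ := h.isBlockCode
  have := hPQ.finrank_le (fun l => cases_none_injective sigma_mk_injective)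
    (fun l => by fin_cases l <;> assumption) 0 (fun _ => rfl)
    (fun y => y.elim ⟨0, 0⟩ fun p => ⟨p.1, p.2.succ⟩) rfl
    (fun l j hj => by obtain ⟨j, rfl⟩ := Fin.exists_succ_eq.2 hj; rfl)
    -- Constant coefficients work because the m_l + 1 ones sum to 1 when m_l = 0 in `F`.
    (fun _ _ => 1) (fun _ => rfl) ?_
  · simpa [Fin.sum_univ_two] using this
  · intro l i hi
    have hl : ((![m₁, m₂] l : ℕ) : F) = 0 := by fin_cases l <;> assumption
    rw [Finset.sum_const, Finset.card_univ, Fintype.card_fin, nsmul_eq_mul, mul_one, Nat.cast_succ,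
      hl, zero_add]

theorem natCast_div_le_of_le_mul_sub {k n K : ℕ} (hn : 0 < n) (hkn : k ≤ n)
    (hk : k ≤ K * (n - k)) : (k : ℝ≥0∞) / n ≤ K / (K + 1) := by
  have h : k * (K + 1) ≤ K * n := by
    obtain ⟨d, rfl⟩ := Nat.exists_eq_add_of_le hkn
    rw [Nat.add_sub_cancel_left] at hk
    nlinarith
  refine ENNReal.div_le_of_le_mul ?_
  rw [← ENNReal.mul_div_right_comm, ENNReal.le_div_iff_mul_le (by simp) (by simp)]
  exact_mod_cast h

/-- Two distinct primes cannot both vanish in a field. So if all prime factors of m vanish, m is a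
power of one prime, with exponent above 1 as m is not prime. -/
theorem exists_prime_factor_cast (m : ℕ) (hm : 2 ≤ m) (hp : ¬ m.Prime) (F : Type u) [Field F] :
    (∃ p ∈ m.primeFactors, ((p ^ m.factorization p : ℕ) : F) ≠ 0) ∨
    ∃ p ∈ m.primeFactors, 1 < m.factorization p ∧ (p : F) = 0 := by
  by_contra! hcon
  obtain ⟨h1, h2⟩ := hcon
  have h0 : ∀ p ∈ m.primeFactors, (p : F) = 0 := fun p hpm =>
    eq_zero_of_pow_eq_zero (n := m.factorization p) (by rw [← Nat.cast_pow]; exact h1 p hpm)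
  have hmin := Nat.minFac_prime (show m ≠ 1 by omega)
  have hmem : m.minFac ∈ m.primeFactors :=
    Nat.mem_primeFactors.2 ⟨hmin, m.minFac_dvd, by omega⟩
  have huniq : ∀ p ∈ m.primeFactors, p = m.minFac := by
    intro p hpm
    by_contra hne
    have hco := (Nat.coprime_primes (Nat.prime_of_mem_primeFactors hpm) hmin).2 hne
    have := (Nat.isCoprime_iff_coprime.2 hco).map (Int.castRingHom F)
    simp [h0 p hpm, h0 _ hmem] at this
  have hfac : m.factorization m.minFac ≤ 1 := not_lt.1 fun hlt => h2 _ hmem hlt (h0 _ hmem)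
  have hsub : m.primeFactors = {m.minFac} :=
    Finset.eq_singleton_iff_unique_mem.2 ⟨hmem, huniq⟩
  have hprod : m = m.minFac ^ m.factorization m.minFac := by
    conv_lhs => rw [← Nat.prod_factorization_pow_eq_self (show m ≠ 0 by omega)]
    rw [Finsupp.prod, Nat.support_factorization, hsub, Finset.prod_singleton]
  have hpos := hmin.factorization_pos_of_dvd (show m ≠ 0 by omega) m.minFac_dvd
  rw [le_antisymm hfac hpos, pow_one] at hprod
  exact hp (hprod ▸ hmin)

theorem isScalarSolvable_N3_gN4 {m p : ℕ} (hm : m ≠ 0) (hp : p ∈ m.primeFactors)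
    (hγ : 1 < m.factorization p) : (N3 p (gN4 m p)).IsScalarSolvable (ZMod m) := by
  have hpp := Nat.prime_of_mem_primeFactors hp
  have hpm := Nat.dvd_of_mem_primeFactors hp
  have : NeZero m := ⟨hm⟩
  -- Multiplication by p determines residues modulo m / p. Since g has one factor p fewer than m,
  -- multiplication by g still determines residues modulo p.
  refine isScalarSolvable_N3 (m := m) (d₁ := m / p) (d₂ := p) (Nat.pos_of_ne_zero hm)
    (Nat.div_mul_cancel hpm) ?_ ?_ (by simp)
  · intro t ht
    obtain ⟨c, rfl⟩ := hpm
    rw [Nat.mul_div_cancel_left _ hpp.pos]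
    push_cast at ht
    exact (mul_dvd_mul_iff_left (by exact_mod_cast hpp.ne_zero)).1 ht
  · intro t ht
    have h1 : ((p ^ m.factorization p : ℕ) : ℤ) ∣ m := by exact_mod_cast Nat.ordProj_dvd m p
    have h2 := h1.trans ht
    obtain ⟨e, he⟩ : ∃ e, m.factorization p = e + 1 := ⟨_, (Nat.succ_pred_eq_of_pos (by omega)).symm⟩
    rw [gN4, he, Nat.add_sub_cancel, pow_succ] at h2
    push_cast at h2
    rw [mul_assoc] at h2
    have h3 := (mul_dvd_mul_iff_left (pow_ne_zero e (by exact_mod_cast hpp.ne_zero))).1 h2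
    have hpZ := Nat.prime_iff_prime_int.1 hpp
    refine (hpZ.dvd_or_dvd h3).resolve_left fun h4 => ?_
    obtain ⟨q, hq, hpq⟩ := (hpZ.dvd_finsetProd_iff _).1 h4
    have h5 : p ∣ q := by exact_mod_cast hpZ.dvd_of_dvd_pow hpq
    have hq' := Finset.mem_erase.1 hq
    exact hq'.1 ((Nat.prime_dvd_prime_iff_eq hpp (Nat.prime_of_mem_primeFactors hq'.2)).1 h5).symm

theorem exists_solution_N4 {m : ℕ} (hm : 2 ≤ m) : ∃ c : (N4 m).Code (ZMod m) 1 1, c.IsSolution := by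
  have hm0 : m ≠ 0 := by omega
  have : NeZero m := ⟨hm0⟩
  unfold N4
  have h : ∀ i, (Sum.elim (fun q : {q // q ∈ (Finset.range (fN4 m)).filter fun q =>
      q.Prime ∧ ¬ q ∣ m} => N1 q.1)
      (Sum.elim (fun p : {p // p ∈ m.primeFactors} =>
        N2 (p.1 ^ m.factorization p.1) (m / p.1 ^ m.factorization p.1))
        (fun p : {p // p ∈ m.primeFactors.filter fun p => 1 < m.factorization p} =>
          N3 p.1 (gN4 m p.1))) i).IsScalarSolvable (ZMod m) := by
    rintro (⟨q, hq⟩ | ⟨p, hp⟩ | ⟨p, hp⟩)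
    · obtain ⟨hqp, hqm⟩ := (Finset.mem_filter.1 hq).2
      exact isScalarSolvable_N1 ((Nat.Prime.coprime_iff_not_dvd hqp).2 hqm)
    · have hpp := Nat.prime_of_mem_primeFactors hp
      have hpos := hpp.factorization_pos_of_dvd hm0 (Nat.dvd_of_mem_primeFactors hp)
      have hdvd := Nat.ordProj_dvd m p
      exact isScalarSolvable_N2 (hpp.two_le.trans (Nat.le_self_pow hpos.ne' p))
        (Nat.ordCompl_pos p hm0) (by simp [Nat.div_mul_cancel hdvd])
    · exact isScalarSolvable_N3_gN4 hm0 (Finset.mem_filter.1 hp).1 (Finset.mem_filter.1 hp).2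
  choose val hval using h
  exact (IsFlow.disjointUnion hval).exists_solution

theorem le_of_isSolution_N4 {m k n : ℕ} (hm : 2 ≤ m) {A : Type u} [Finite A] [Nontrivial A]
    {c : (N4 m).Code A k n} (hc : c.IsSolution) : k ≤ n := by
  obtain ⟨a⟩ := (inferInstance : Nonempty A)
  have hmem : m.minFac ∈ m.primeFactors :=
    Nat.mem_primeFactors.2 ⟨Nat.minFac_prime (by omega), m.minFac_dvd, by omega⟩
  unfold N4 at c
  exact (hc.isFlow.component (.inr (.inl ⟨_, hmem⟩)) fun _ _ => a).le_of_N2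
    (Nat.ordCompl_pos _ (by omega))

theorem capacity_N4 {m : ℕ} (hm : 2 ≤ m) : (N4 m).capacity = 1 := by
  refine le_antisymm (sSup_le ?_) (le_sSup ?_)
  · rintro _ ⟨k, n, -, hn, rfl, A, _, _, c, hc⟩
    refine ENNReal.div_le_of_le_mul ?_
    rw [one_mul]
    exact_mod_cast le_of_isSolution_N4 hm hc
  · have : NeZero m := ⟨by omega⟩
    have : Fact (1 < m) := ⟨hm⟩
    exact ⟨1, 1, one_pos, one_pos, by simp, ZMod m, inferInstance, inferInstance,
      exists_solution_N4 hm⟩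

theorem exists_linearCapacity_N4_le {m : ℕ} (hm : 2 ≤ m) (hp : ¬ m.Prime) :
    ∃ c : ℝ≥0∞, c < 1 ∧ ∀ (F : Type u) [Field F], (N4 m).linearCapacity F ≤ c := by
  let K₂ : ℕ → ℕ := fun p => 3 * (m / p ^ m.factorization p * (p ^ m.factorization p + 2))
  let K₃ : ℕ → ℕ := fun p => 3 * (p + 1 + (gN4 m p + 1))
  -- Summing over all primes gives one constant that serves whichever component obstructs the given
  -- field.
  let K := ∑ p ∈ m.primeFactors, (K₂ p + K₃ p)
  have hK : ∀ p ∈ m.primeFactors, K₂ p + K₃ p ≤ K := fun p hp =>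
    Finset.single_le_sum (f := fun p => K₂ p + K₃ p) (fun _ _ => Nat.zero_le _) hp
  refine ⟨K / (K + 1), ?_, fun F _ => sSup_le ?_⟩
  · rw [ENNReal.div_lt_iff (by simp) (by simp), one_mul]
    exact_mod_cast Nat.lt_succ_self K
  rintro _ ⟨k, n, -, hn, rfl, c, hl, hs⟩
  have hflow := hl.isLinearFlow hs
  unfold N4 at hflow
  suffices h : k ≤ n ∧ k ≤ K * (n - k) from natCast_div_le_of_le_mul_sub hn h.1 h.2
  obtain ⟨p, hpm, hpF⟩ | ⟨p, hpm, hγ, hpF⟩ := exists_prime_factor_cast m hm hp F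
  · obtain ⟨h1, h2⟩ := (hflow.component (.inr (.inl ⟨p, hpm⟩))).le_of_N2
      (Nat.ordCompl_pos p (by omega)) hpF
    exact ⟨h1, h2.trans (Nat.mul_le_mul_right _ (le_trans (Nat.le_add_right _ _) (hK p hpm)))⟩
  · have hpp := Nat.prime_of_mem_primeFactors hpm
    have hg0 : gN4 m p ≠ 0 := mul_ne_zero (pow_ne_zero _ hpp.ne_zero)
      (Finset.prod_ne_zero_iff.2 fun q hq =>
        pow_ne_zero _ (Nat.prime_of_mem_primeFactors (Finset.mem_of_mem_erase hq)).ne_zero)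
    have hgF : (gN4 m p : F) = 0 := by
      rw [gN4, Nat.cast_mul, Nat.cast_pow, hpF, zero_pow (by omega), zero_mul]
    obtain ⟨h1, h2⟩ := (hflow.component (.inr (.inr ⟨p, Finset.mem_filter.2 ⟨hpm, hγ⟩⟩))).le_of_N3
      hpp.ne_zero hg0 hpF hgF
    exact ⟨h1, h2.trans (Nat.mul_le_mul_right _ (le_trans (Nat.le_add_left _ _) (hK p hpm)))⟩

end Network

theorem theorem5p7 (m : ℕ) (hm : 2 ≤ m) :
    (Network.N4 m).capacity = 1 ∧
    (¬ m.Prime →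
      ∃ c : ℝ≥0∞, c < 1 ∧ ∀ (F : Type u) [Field F] [Finite F],
        (Network.N4 m).linearCapacity F ≤ c) := by
  refine ⟨Network.capacity_N4 hm, fun hp => ?_⟩
  obtain ⟨c, hc, h⟩ := Network.exists_linearCapacity_N4_le.{u} hm hp
  exact ⟨c, hc, fun F _ _ => h F⟩
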